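/- Let $F\in C^\infty(\mathbb R,\mathbb R)$, put $$f(\rho,\tau)=1+\frac{1}{(6\rho)^{1/3}}\,F\!\left(\frac{\tau}{(6\rho)^{1/3}}\right),\qquad A(\rho,\tau)=-6\,\partial_\tau^2\log f(\rho,\tau),$$ and suppose that, on the set of all $(\rho,\tau)$ with $\rho>0$ and $f(\rho,\tau)>0$ (where the formula for $A$ makes sense), $A$ is a classical solution of the cylindrical Korteweg--de Vries (cKdV) equation $$2\,\partial_\rho A+\rho^{-1}A+\partial_\tau^3A=\partial_\tau(A^2),$$ and that for every $\rho>0$ the function $A(\rho,\cdot)$ is bounded on the set of all $\tau$ with $f(\rho,\tau)>0$. If $A$ is not identically zero, then for every $\rho>0$: $f(\rho,\tau)>0$ for all $\tau\in\mathbb R$ (so that $A(\rho,\cdot)$ is defined on all of $\mathbb R$); $A(\rho,\tau)\to0$ as $|\tau|\to\infty$; $A$ has zero mean, $\int_{\mathbb R}A(\rho,\tau)\,d\tau=0$, where the integral is an improper one, i.e. $A(\rho,\cdot)$ is locally integrable and $\int_a^bA(\rho,\tau)\,d\tau\to0$ as $a\to-\infty$ and $b\to+\infty$ independently; and $A(\rho,\cdot)\notin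 L^2(\mathbb R)$. (For the trivial solution $A\equiv0$ the decay and the zero mean hold as well, but it is of course square integrable.) -/

import Mathlib

open Filter Topology MeasureTheory
open scoped ContDiff

noncomputable section

namespace CKdV

/-- The self-similar argument `1 + (6ρ)^{-1/3} F(τ / (6ρ)^{1/3})` of the logarithm. -/
def selfSimilar (F : ℝ → ℝ) (ρ τ : ℝ) : ℝ :=
  1 + 1 / (6 * ρ) ^ ((1 : ℝ) / 3) * F (τ / (6 * ρ) ^ ((1 : ℝ) / 3))

/-- `A(ρ, τ) = -6 ∂_τ² log [1 + (6ρ)^{-1/3} F(τ / (6ρ)^{1/3})]`. -/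
def wave (F : ℝ → ℝ) (ρ τ : ℝ) : ℝ :=
  -6 * iteratedDeriv 2 (fun t => Real.log (selfSimilar F ρ t)) τ

/-- The open set of all `(ρ, τ)` with `ρ > 0` at which the argument of the logarithm is positive,
so that the formula for `wave F` makes sense there. -/
def waveDomain (F : ℝ → ℝ) : Set (ℝ × ℝ) :=
  {p | 0 < p.1 ∧ 0 < selfSimilar F p.1 p.2}

/-- `A` is a classical solution of `2 ∂_ρ A + ρ⁻¹ A + ∂_τ³ A = ∂_τ (A²)` on the open set `U`. -/
def IsSolutionOn (U : Set (ℝ × ℝ)) (A : ℝ → ℝ → ℝ) : Prop :=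
  ∀ ρ τ : ℝ, (ρ, τ) ∈ U →
    DifferentiableAt ℝ (fun r => A r τ) ρ ∧ ContDiffAt ℝ 3 (A ρ) τ ∧
    2 * deriv (fun r => A r τ) ρ + ρ⁻¹ * A ρ τ + iteratedDeriv 3 (A ρ) τ
      = deriv (fun t => A ρ t ^ 2) τ

/-- For each `ρ > 0`, the function `A(ρ, ·)` is bounded on the slice of `U` at `ρ`. -/
def IsBoundedOnSlices (U : Set (ℝ × ℝ)) (A : ℝ → ℝ → ℝ) : Prop :=
  ∀ ρ : ℝ, 0 < ρ → ∃ M : ℝ, ∀ τ : ℝ, (ρ, τ) ∈ U → |A ρ τ| ≤ M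

/-- `∫_ℝ g = I` as an improper integral: `g` is locally integrable and `∫_a^b g → I` as
`a → -∞` and `b → +∞` independently. -/
def HasImproperIntegral (g : ℝ → ℝ) (I : ℝ) : Prop :=
  LocallyIntegrable g volume ∧
    Tendsto (fun p : ℝ × ℝ => ∫ t in p.1..p.2, g t) (atBot ×ˢ atTop) (𝓝 I)

end CKdV

end

noncomputable section

namespace CKdV

/-! Put `s = (6ρ)^{1/3}` and `z = τ/s`. After clearing denominators, cKdV is a quadratic in `s + F
z`. At fixed `z` the scale `s` still varies, so all three coefficients vanish
(`quadratic_of_isSolutionOn`). Integrating them shows that a nonconstant `F` is, up to sign, `y'² -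
z y²` with `y'' = z y`, hence `F' = ∓y²` (`profile_equations`, `isAirySquare_of_profile`).

If `F` is negative with `F' ≠ 0` somewhere, `s + F` has a simple zero for a suitable `s` and the
wave blows up there. Boundedness thus selects the sign `F' = -y²` and forces `F ≥ 0`, which keeps
the logarithm defined and excludes the growing Airy solution at `+∞`.

The wave is the `τ`-derivative of `-(6/s) F'/(s + F)`, so decay and zero mean reduce to limits of
`F'/(s + F)` and `F''/(s + F)`. Towards `-∞` the oscillation makes `(y y'/F)²` average `1/(8|z|)`,
and the logarithmic divergence of its integral rules out `L²` (`not_integrableOn_of_sq_le`). -/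

theorem iteratedDeriv_two_eq_of_hasDerivAt {h g₀ g₁ g₂ : ℝ → ℝ} {U : Set ℝ} (hU : IsOpen U)
    (h₀ : ∀ t ∈ U, h t = g₀ t) (h₁ : ∀ t ∈ U, HasDerivAt g₀ (g₁ t) t)
    (h₂ : ∀ t ∈ U, HasDerivAt g₁ (g₂ t) t) {t : ℝ} (ht : t ∈ U) :
    iteratedDeriv 2 h t = g₂ t := by
  have e₁ : ∀ t ∈ U, deriv h t = g₁ t := fun t ht => by
    have : h =ᶠ[𝓝 t] g₀ := by filter_upwards [hU.mem_nhds ht] with y hy using h₀ y hy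
    rw [this.deriv_eq, (h₁ t ht).deriv]
  have : deriv h =ᶠ[𝓝 t] g₁ := by filter_upwards [hU.mem_nhds ht] with y hy using e₁ y hy
  rw [iteratedDeriv_succ, iteratedDeriv_one, this.deriv_eq, (h₂ t ht).deriv]

theorem iteratedDeriv_three_eq_of_hasDerivAt {h g₀ g₁ g₂ g₃ : ℝ → ℝ} {U : Set ℝ} (hU : IsOpen U)
    (h₀ : ∀ t ∈ U, h t = g₀ t) (h₁ : ∀ t ∈ U, HasDerivAt g₀ (g₁ t) t)
    (h₂ : ∀ t ∈ U, HasDerivAt g₁ (g₂ t) t) (h₃ : ∀ t ∈ U, HasDerivAt g₂ (g₃ t) t)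
    {t : ℝ} (ht : t ∈ U) :
    iteratedDeriv 3 h t = g₃ t := by
  have : iteratedDeriv 2 h =ᶠ[𝓝 t] g₂ := by
    filter_upwards [hU.mem_nhds ht] with y hy
    exact iteratedDeriv_two_eq_of_hasDerivAt hU h₀ h₁ h₂ hy
  rw [iteratedDeriv_succ, this.deriv_eq, (h₃ t ht).deriv]

/-- The length scale `(6ρ)^{1/3}` of the self-similar variable. -/
def scale (ρ : ℝ) : ℝ := (6 * ρ) ^ ((1 : ℝ) / 3)

theorem scale_pos {ρ : ℝ} (hρ : 0 < ρ) : 0 < scale ρ := Real.rpow_pos_of_pos (by positivity) _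

theorem scale_cube {s : ℝ} (hs : 0 < s) : scale (s ^ 3 / 6) = s := by
  unfold scale
  rw [show 6 * (s ^ 3 / 6) = s ^ (3 : ℝ) by norm_cast; ring, ← Real.rpow_mul hs.le]
  norm_num

theorem hasDerivAt_scale {ρ : ℝ} (hρ : 0 < ρ) : HasDerivAt scale (2 / scale ρ ^ 2) ρ := by
  have h6 : 0 < 6 * ρ := by positivity
  have h := ((hasDerivAt_id ρ).const_mul 6).rpow_const (p := (1 : ℝ) / 3) (Or.inl h6.ne')
  refine h.congr_deriv ?_
  unfold scale
  rw [← Real.rpow_natCast, ← Real.rpow_mul h6.le, id_eq]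
  norm_num
  rw [Real.rpow_neg h6.le]
  ring

theorem selfSimilar_eq (F : ℝ → ℝ) (ρ τ : ℝ) :
    selfSimilar F ρ τ = 1 + 1 / scale ρ * F (τ / scale ρ) := rfl

theorem selfSimilar_eq_div {F : ℝ → ℝ} {ρ : ℝ} (hρ : 0 < ρ) (τ : ℝ) :
    selfSimilar F ρ τ = (scale ρ + F (τ / scale ρ)) / scale ρ := by
  have := scale_pos hρ
  rw [selfSimilar_eq]; field_simp

theorem selfSimilar_pos_iff {F : ℝ → ℝ} {ρ : ℝ} (hρ : 0 < ρ) (τ : ℝ) :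
    0 < selfSimilar F ρ τ ↔ 0 < scale ρ + F (τ / scale ρ) := by
  rw [selfSimilar_eq_div hρ, div_pos_iff_of_pos_right (scale_pos hρ)]

theorem hasDerivAt_comp_div {g g' : ℝ → ℝ} (hg : ∀ z, HasDerivAt g (g' z) z) (s t : ℝ) :
    HasDerivAt (fun t => g (t / s)) (g' (t / s) / s) t := by
  have := (hg (t / s)).comp t ((hasDerivAt_id t).div_const s)
  simpa [Function.comp_def, div_eq_mul_inv] using this

/-! ### cKdV in the self-similar variable -/

section Formula

variable {F F₁ F₂ F₃ F₄ F₅ : ℝ → ℝ}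

/-- On its domain, the wave is a rational expression in the profile and its derivatives. -/
theorem wave_eq (h₁ : ∀ z, HasDerivAt F (F₁ z) z) (h₂ : ∀ z, HasDerivAt F₁ (F₂ z) z)
    {ρ τ : ℝ} (hρ : 0 < ρ) (hpos : 0 < scale ρ + F (τ / scale ρ)) :
    wave F ρ τ = -6 / scale ρ ^ 2 * (F₂ (τ / scale ρ) / (scale ρ + F (τ / scale ρ))
      - (F₁ (τ / scale ρ) / (scale ρ + F (τ / scale ρ))) ^ 2) := by
  have hs := scale_pos hρ
  set s := scale ρ with hsdef
  have hFc : Continuous F := continuous_iff_continuousAt.2 fun z => (h₁ z).continuousAt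
  have hU : IsOpen {t : ℝ | 0 < s + F (t / s)} := isOpen_lt continuous_const (by fun_prop)
  have key := iteratedDeriv_two_eq_of_hasDerivAt hU
    (h := fun t => Real.log (selfSimilar F ρ t))
    (g₀ := fun t => Real.log (s + F (t / s)) - Real.log s)
    (g₁ := fun t => F₁ (t / s) / s / (s + F (t / s)))
    (g₂ := fun t => (F₂ (t / s) / s / s * (s + F (t / s)) - F₁ (t / s) / s * (F₁ (t / s) / s))
      / (s + F (t / s)) ^ 2)
    (fun t ht => by
      rw [selfSimilar_eq_div hρ, Real.log_div (ne_of_gt ht) hs.ne'])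
    (fun t ht => (((hasDerivAt_comp_div h₁ s t).const_add s).log (ne_of_gt ht)).sub_const _)
    (fun t ht => ((hasDerivAt_comp_div h₂ s t).div_const s).div
      ((hasDerivAt_comp_div h₁ s t).const_add s) (ne_of_gt ht)) hpos
  rw [wave, key]
  field_simp

/-- The cylindrical KdV equation for the wave, written as a quadratic polynomial in
`(6ρ)^{1/3} + F`. -/
theorem quadratic_of_isSolutionOn
    (h₁ : ∀ z, HasDerivAt F (F₁ z) z) (h₂ : ∀ z, HasDerivAt F₁ (F₂ z) z)
    (h₃ : ∀ z, HasDerivAt F₂ (F₃ z) z) (h₄ : ∀ z, HasDerivAt F₃ (F₄ z) z)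
    (h₅ : ∀ z, HasDerivAt F₄ (F₅ z) z)
    (hsol : IsSolutionOn (waveDomain F) (wave F)) {s z : ℝ} (hs : 0 < s) (hN : 0 < s + F z) :
    (s + F z) ^ 2 * (F₅ z - 6 * F₂ z - 4 * z * F₃ z)
      + (s + F z) * (8 * F₁ z ^ 2 + 4 * F z * F₂ z + 8 * z * F₁ z * F₂ z + 2 * F₂ z * F₃ z
        - 4 * F₁ z * F₄ z - (F₄ z - 4 * z * F₂ z - 2 * F₁ z) * F₁ z)
      - 2 * F₁ z * (4 * F z * F₁ z + 4 * z * F₁ z ^ 2 - 4 * F₁ z * F₃ z + 3 * F₂ z ^ 2) = 0 := by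
  set ρ := s ^ 3 / 6 with hρdef
  have hρ : 0 < ρ := by positivity
  have hsc : scale ρ = s := scale_cube hs
  set τ := s * z with hτdef
  have hτ : τ / s = z := by rw [hτdef]; field_simp
  have hFc : Continuous F := continuous_iff_continuousAt.2 fun z => (h₁ z).continuousAt
  have hU : IsOpen {t : ℝ | 0 < s + F (t / s)} := isOpen_lt continuous_const (by fun_prop)
  have hτU : τ ∈ {t : ℝ | 0 < s + F (t / s)} := by simpa [hτ] using hN
  have heq := (hsol ρ τ ⟨hρ, by rw [selfSimilar_pos_iff hρ, hsc, hτ]; exact hN⟩).2.2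
  have hd₀ := hasDerivAt_comp_div h₁ s
  have hd₁ := hasDerivAt_comp_div h₂ s
  have hd₂ := hasDerivAt_comp_div h₃ s
  have hd₃ := hasDerivAt_comp_div h₄ s
  have hd₄ := hasDerivAt_comp_div h₅ s
  -- the `τ`-derivatives
  let G₀ : ℝ → ℝ := fun t => -6 / s ^ 2 * (F₂ (t / s) / (s + F (t / s))
      - (F₁ (t / s) / (s + F (t / s))) ^ 2)
  let G₁ : ℝ → ℝ := fun t => -6 / s ^ 3 * (F₃ (t / s) / (s + F (t / s))
      - 3 * (F₁ (t / s) / (s + F (t / s))) * (F₂ (t / s) / (s + F (t / s)))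
      + 2 * (F₁ (t / s) / (s + F (t / s))) ^ 3)
  let G₂ : ℝ → ℝ := fun t => -6 / s ^ 4 * (F₄ (t / s) / (s + F (t / s))
      - 4 * (F₁ (t / s) / (s + F (t / s))) * (F₃ (t / s) / (s + F (t / s)))
      - 3 * (F₂ (t / s) / (s + F (t / s))) ^ 2
      + 12 * (F₁ (t / s) / (s + F (t / s))) ^ 2 * (F₂ (t / s) / (s + F (t / s)))
      - 6 * (F₁ (t / s) / (s + F (t / s))) ^ 4)
  let G₃ : ℝ → ℝ := fun t => -6 / s ^ 5 * (F₅ (t / s) / (s + F (t / s))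
      - 5 * (F₁ (t / s) / (s + F (t / s))) * (F₄ (t / s) / (s + F (t / s)))
      - 10 * (F₂ (t / s) / (s + F (t / s))) * (F₃ (t / s) / (s + F (t / s)))
      + 20 * (F₁ (t / s) / (s + F (t / s))) ^ 2 * (F₃ (t / s) / (s + F (t / s)))
      + 30 * (F₁ (t / s) / (s + F (t / s))) * (F₂ (t / s) / (s + F (t / s))) ^ 2
      - 60 * (F₁ (t / s) / (s + F (t / s))) ^ 3 * (F₂ (t / s) / (s + F (t / s)))
      + 24 * (F₁ (t / s) / (s + F (t / s))) ^ 5)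
  have quot : ∀ (f f' : ℝ → ℝ), (∀ t, HasDerivAt (fun t => f (t / s)) (f' (t / s) / s) t) →
      ∀ t ∈ {t : ℝ | 0 < s + F (t / s)}, HasDerivAt (fun t => f (t / s) / (s + F (t / s)))
        ((f' (t / s) / (s + F (t / s))
          - f (t / s) / (s + F (t / s)) * (F₁ (t / s) / (s + F (t / s)))) / s) t := by
    intro f f' hf t ht
    have ht' : s + F (t / s) ≠ 0 := ne_of_gt ht
    refine ((hf t).div ((hd₀ t).const_add s) ht').congr_deriv ?_
    field_simp
  have q₁ := quot F₁ F₂ hd₁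
  have q₂ := quot F₂ F₃ hd₂
  have q₃ := quot F₃ F₄ hd₃
  have q₄ := quot F₄ F₅ hd₄
  have w₀ : ∀ t ∈ {t : ℝ | 0 < s + F (t / s)}, wave F ρ t = G₀ t := fun t ht => by
    have := wave_eq h₁ h₂ (ρ := ρ) (τ := t) hρ (by rw [hsc]; exact ht)
    rwa [hsc] at this
  have g₁ : ∀ t ∈ {t : ℝ | 0 < s + F (t / s)}, HasDerivAt G₀ (G₁ t) t := fun t ht => by
    refine (((q₂ t ht).fun_sub ((q₁ t ht).fun_pow 2)).const_mul (-6 / s ^ 2)).congr_deriv ?_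
    simp only [G₁, Nat.cast_ofNat, Nat.reduceSub]; ring
  have g₂ : ∀ t ∈ {t : ℝ | 0 < s + F (t / s)}, HasDerivAt G₁ (G₂ t) t := fun t ht => by
    refine ((((q₃ t ht).fun_sub (((q₁ t ht).const_mul 3).fun_mul (q₂ t ht))).fun_add
      (((q₁ t ht).fun_pow 3).const_mul 2)).const_mul (-6 / s ^ 3)).congr_deriv ?_
    simp only [G₂, Nat.cast_ofNat, Nat.reduceSub]; ring
  have g₃ : ∀ t ∈ {t : ℝ | 0 < s + F (t / s)}, HasDerivAt G₂ (G₃ t) t := fun t ht => by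
    refine ((((((q₄ t ht).fun_sub (((q₁ t ht).const_mul 4).fun_mul (q₃ t ht))).fun_sub
      (((q₂ t ht).fun_pow 2).const_mul 3)).fun_add
      ((((q₁ t ht).fun_pow 2).const_mul 12).fun_mul (q₂ t ht))).fun_sub
      (((q₁ t ht).fun_pow 4).const_mul 6)).const_mul (-6 / s ^ 4)).congr_deriv ?_
    simp only [G₃, Nat.cast_ofNat, Nat.reduceSub]; ring
  have e₃ : iteratedDeriv 3 (wave F ρ) τ = G₃ τ :=
    iteratedDeriv_three_eq_of_hasDerivAt hU w₀ g₁ g₂ g₃ hτU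
  have e₁ : deriv (fun t => wave F ρ t ^ 2) τ = 2 * G₀ τ * G₁ τ := by
    have : (fun t => wave F ρ t ^ 2) =ᶠ[𝓝 τ] fun t => G₀ t ^ 2 := by
      filter_upwards [hU.mem_nhds hτU] with t ht
      rw [w₀ t ht]
    rw [this.deriv_eq, ((g₁ τ hτU).fun_pow 2).deriv]; ring
  -- the `ρ`-derivative
  have hds := hasDerivAt_scale hρ
  have hz : HasDerivAt (fun r => τ / scale r) (-(2 * z / s ^ 3)) ρ := by
    refine ((hasDerivAt_const ρ τ).div hds (by rw [hsc]; exact hs.ne')).congr_deriv ?_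
    rw [hsc, hτdef]; field_simp; ring
  have hzρ : τ / scale ρ = z := by rw [hsc, hτ]
  have comp : ∀ (f f' : ℝ → ℝ), (∀ z, HasDerivAt f (f' z) z) →
      HasDerivAt (fun r => f (τ / scale r)) (f' z * (-(2 * z / s ^ 3))) ρ := by
    intro f f' hf
    have := (hf (τ / scale ρ)).comp ρ hz
    rwa [hzρ] at this
  have hN' : scale ρ + F (τ / scale ρ) ≠ 0 := by rw [hzρ, hsc]; exact hN.ne'
  have dN := hds.fun_add (comp F F₁ h₁)
  have dA := (((hasDerivAt_const ρ (-6 : ℝ)).fun_div (hds.fun_pow 2)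
      (by rw [hsc]; positivity)).fun_mul
    (((comp F₂ F₃ h₃).fun_div dN hN').fun_sub (((comp F₁ F₂ h₂).fun_div dN hN').fun_pow 2)))
  have er : (fun r => wave F r τ) =ᶠ[𝓝 ρ] fun r => -6 / scale r ^ 2 *
      (F₂ (τ / scale r) / (scale r + F (τ / scale r))
        - (F₁ (τ / scale r) / (scale r + F (τ / scale r))) ^ 2) := by
    have c₁ : ContinuousAt (fun r => scale r + F (τ / scale r)) ρ := dN.continuousAt
    have c₂ := c₁.eventually (lt_mem_nhds (a := 0)
      (show (0 : ℝ) < scale ρ + F (τ / scale ρ) by rw [hzρ, hsc]; exact hN))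
    filter_upwards [c₂, lt_mem_nhds hρ] with r hr hr0
    exact wave_eq h₁ h₂ hr0 hr
  have eρ := er.deriv_eq.trans dA.deriv
  rw [eρ, e₃, e₁, w₀ τ hτU] at heq
  simp only [G₀, G₁, G₃, hsc, hτ, Nat.cast_ofNat, Nat.reduceSub] at heq
  rw [show ρ⁻¹ = 6 / s ^ 3 by rw [hρdef]; field_simp] at heq
  generalize F z = a, F₁ z = a₁, F₂ z = a₂, F₃ z = a₃, F₄ z = a₄, F₅ z = a₅ at *
  obtain ⟨N, rfl⟩ : ∃ N, a = N - s := ⟨s + a, by ring⟩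
  simp only [add_sub_cancel] at heq hN ⊢
  rw [← sub_eq_zero] at heq
  -- The factor clears all denominators; the terms of higher degree in `1/N` cancel, leaving degree
  -- two in `N`.
  refine Eq.trans ?_ ((congrArg (fun x => -s ^ 5 * N ^ 3 / 6 * x) heq).trans (mul_zero _))
  field_simp
  ring

end Formula

/-! ### Integrating the profile equations -/

theorem eq_of_forall_hasDerivAt_zero {g : ℝ → ℝ} (hg : ∀ z, HasDerivAt g 0 z) (x y : ℝ) :
    g x = g y :=
  is_const_of_deriv_eq_zero (fun z => (hg z).differentiableAt) (fun z => (hg z).deriv) x y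

theorem coeffs_eq_zero_of_quadratic {a b c m : ℝ}
    (h : ∀ x : ℝ, m < x → x ^ 2 * a + x * b - c = 0) : a = 0 ∧ b = 0 ∧ c = 0 := by
  have e₁ := h (m + 1) (by linarith)
  have e₂ := h (m + 2) (by linarith)
  have e₃ := h (m + 3) (by linarith)
  have ha : a = 0 := by linear_combination (e₁ - 2 * e₂ + e₃) / 2
  subst ha
  have hb : b = 0 := by linear_combination e₂ - e₁
  subst hb
  exact ⟨rfl, rfl, by linarith⟩

section Profile

variable {F F₁ F₂ F₃ F₄ F₅ : ℝ → ℝ}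

/-- A nonconstant profile of a solution satisfies `F''' = 4 z F' - 2 F` together with
a first integral of this equation: it is the antiderivative of the square of an Airy function,
up to sign. -/
theorem profile_equations
    (h₁ : ∀ z, HasDerivAt F (F₁ z) z) (h₂ : ∀ z, HasDerivAt F₁ (F₂ z) z)
    (h₃ : ∀ z, HasDerivAt F₂ (F₃ z) z) (h₄ : ∀ z, HasDerivAt F₃ (F₄ z) z)
    (h₅ : ∀ z, HasDerivAt F₄ (F₅ z) z)
    (hsol : IsSolutionOn (waveDomain F) (wave F)) {z₁ : ℝ} (hz₁ : F₁ z₁ ≠ 0) (z : ℝ) :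
    F₃ z = 4 * z * F₁ z - 2 * F z ∧ F₂ z ^ 2 = 4 * z * F₁ z ^ 2 - 4 * F z * F₁ z := by
  have coeffs := fun z => coeffs_eq_zero_of_quadratic (m := |F z|)
    (fun x hx => by
      have := quadratic_of_isSolutionOn h₁ h₂ h₃ h₄ h₅ hsol (s := x - F z) (z := z)
        (by linarith [le_abs_self (F z)]) (by linarith [abs_nonneg (F z)])
      rwa [sub_add_cancel] at this)
  -- In these terms the three coefficients read `L'`, `Q' - L F₁` and `2 F₁ Q`.
  let L : ℝ → ℝ := fun z => F₄ z - 4 * z * F₂ z - 2 * F₁ z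
  let Q : ℝ → ℝ := fun z => 4 * F z * F₁ z + 4 * z * F₁ z ^ 2 - 4 * F₁ z * F₃ z + 3 * F₂ z ^ 2
  have hL : ∀ z, HasDerivAt L 0 z := fun z => by
    refine (((h₅ z).fun_sub (((hasDerivAt_id z).const_mul 4).fun_mul (h₃ z))).fun_sub
      ((h₂ z).const_mul 2)).congr_deriv ?_
    simp only [id_eq]
    linear_combination (coeffs z).1
  have hQ : ∀ z, HasDerivAt Q (L z * F₁ z) z := fun z => by
    refine ((((((h₁ z).const_mul 4).fun_mul (h₂ z)).fun_add
      (((hasDerivAt_id z).const_mul 4).fun_mul ((h₂ z).fun_pow 2))).fun_sub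
      (((h₂ z).const_mul 4).fun_mul (h₄ z))).fun_add
      (((h₃ z).fun_pow 2).const_mul 3)).congr_deriv ?_
    simp only [id_eq, L, Nat.cast_ofNat, Nat.reduceSub]
    linear_combination (coeffs z).2.1
  have hFQ : ∀ z, F₁ z * Q z = 0 := fun z => by
    linear_combination (coeffs z).2.2 / 2
  -- `F₁ Q = 0` alone does not give `Q = 0` at zeros of `F₁`, but it makes `(Q²)' = 2 L F₁ Q`
  -- vanish, so `Q` is zero everywhere once it is zero at `z₁`.
  have hQ2 : ∀ z, HasDerivAt (fun z => Q z ^ 2) 0 z := fun z => by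
    refine ((hQ z).fun_pow 2).congr_deriv ?_
    simp only [Nat.cast_ofNat, Nat.reduceSub]
    linear_combination 2 * L z * hFQ z
  have hQz₁ : Q z₁ = 0 := (mul_eq_zero.1 (hFQ z₁)).resolve_left hz₁
  have hQ0 : ∀ z, Q z = 0 := fun z => by
    have := eq_of_forall_hasDerivAt_zero hQ2 z z₁
    simpa [hQz₁] using this
  have hLz₁ : L z₁ = 0 := by
    have := (hQ z₁).unique ((hasDerivAt_const z₁ (0 : ℝ)).congr_of_eventuallyEq
      (Eventually.of_forall hQ0))
    exact (mul_eq_zero.1 this).resolve_right hz₁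
  have hL0 : ∀ z, L z = 0 := fun z => (eq_of_forall_hasDerivAt_zero hL z z₁).trans hLz₁
  -- Two first integrals of `L = 0`; the relation `Q = 0` ties them together as `4 k F₁ = 3 C`. A
  -- nonzero `k` would make `F₁` constant, and then `L = 0` forces `F₁ = 0`.
  let k : ℝ → ℝ := fun z => F z - 2 * z * F₁ z + F₃ z / 2
  let C : ℝ → ℝ := fun z => 2 * F₁ z * F₃ z - F₂ z ^ 2 - 4 * z * F₁ z ^ 2
  have hk : ∀ z, HasDerivAt k 0 z := fun z => by
    refine (((h₁ z).fun_sub (((hasDerivAt_id z).const_mul 2).fun_mul (h₂ z))).fun_add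
      ((h₄ z).div_const 2)).congr_deriv ?_
    simp only [id_eq]
    linear_combination hL0 z / 2
  have hC : ∀ z, HasDerivAt C 0 z := fun z => by
    refine (((((h₂ z).const_mul 2).fun_mul (h₄ z)).fun_sub ((h₃ z).fun_pow 2)).fun_sub
      (((hasDerivAt_id z).const_mul 4).fun_mul ((h₂ z).fun_pow 2))).congr_deriv ?_
    simp only [id_eq, Nat.cast_ofNat, Nat.reduceSub]
    linear_combination 2 * F₁ z * hL0 z
  have hrel : ∀ z, 4 * k z * F₁ z = 3 * C z := fun z => by
    simp only [k, C]
    linear_combination hQ0 z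
  have hk0 : k z = 0 := by
    by_contra hkz
    have hkc := fun y => eq_of_forall_hasDerivAt_zero hk y z
    have hCc := fun y => eq_of_forall_hasDerivAt_zero hC y z
    have hF₁ : ∀ y, F₁ y = 3 * C z / (4 * k z) := fun y => by
      rw [eq_div_iff (by simpa using hkz), ← hCc y, ← hrel y, hkc y]; ring
    have hF₂ : ∀ y, F₂ y = 0 := fun y => (h₂ y).unique
      ((hasDerivAt_const y _).congr_of_eventuallyEq (Eventually.of_forall hF₁))
    have hF₃ : ∀ y, F₃ y = 0 := fun y => (h₃ y).unique
      ((hasDerivAt_const y _).congr_of_eventuallyEq (Eventually.of_forall hF₂))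
    have hF₄ : ∀ y, F₄ y = 0 := fun y => (h₄ y).unique
      ((hasDerivAt_const y _).congr_of_eventuallyEq (Eventually.of_forall hF₃))
    apply hz₁
    have := hL0 z₁
    simp only [L, hF₄, hF₂] at this
    linarith
  have hC0 : C z = 0 := by
    have := hrel z
    rw [hk0] at this
    linarith
  simp only [k, C] at hk0 hC0
  have e : F₃ z = 4 * z * F₁ z - 2 * F z := by linear_combination 2 * hk0
  refine ⟨e, ?_⟩
  rw [e] at hC0
  linear_combination -hC0

end Profile

/-! ### Squares of Airy functions -/

/-- The quantities `P = y²`, `R = y y'`, `E = y'²` attached to a solution of the Airy equation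
`y'' = z y`, up to a common sign. -/
structure IsAirySquare (P R E : ℝ → ℝ) : Prop where
  hasDerivAt_P : ∀ z, HasDerivAt P (2 * R z) z
  hasDerivAt_R : ∀ z, HasDerivAt R (E z + z * P z) z
  hasDerivAt_E : ∀ z, HasDerivAt E (2 * z * R z) z
  mul_eq : ∀ z, P z * E z = R z ^ 2

namespace IsAirySquare

variable {P R E : ℝ → ℝ}

/-- Grönwall in both directions: `P E = R²` gives `|2R| ≤ |P + E|`, so the derivative of `(P + E)²`
is at most `4 + 2z²` times `(P + E)²` in absolute value. The exponential weights integrate this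
rate. -/
theorem P_add_E_eq_zero (h : IsAirySquare P R E) {z₀ : ℝ} (h₀ : P z₀ + E z₀ = 0) (z : ℝ) :
    P z + E z = 0 := by
  have hS : ∀ z, HasDerivAt (fun z => P z + E z) (2 * (1 + z) * R z) z := fun z =>
    ((h.hasDerivAt_P z).fun_add (h.hasDerivAt_E z)).congr_deriv (by ring)
  have hb : ∀ z, |2 * (P z + E z) * (2 * (1 + z) * R z)| ≤ (4 + 2 * z ^ 2) * (P z + E z) ^ 2 := by
    intro z
    have hR : |2 * R z| ≤ |P z + E z| := by
      apply sq_le_sq.1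
      nlinarith [h.mul_eq z, sq_nonneg (P z - E z)]
    have h1 : |1 + z| ≤ 2 + z ^ 2 := by
      rw [abs_le]; constructor <;> nlinarith [sq_nonneg (z + 1), sq_nonneg (z - 1), sq_nonneg z]
    calc |2 * (P z + E z) * (2 * (1 + z) * R z)|
        = 2 * |P z + E z| * (|1 + z| * |2 * R z|) := by
          rw [← abs_mul, show (1 + z) * (2 * R z) = 2 * (1 + z) * R z by ring, abs_mul, abs_mul,
            abs_two]
      _ ≤ 2 * |P z + E z| * ((2 + z ^ 2) * |P z + E z|) := by gcongr
      _ = (4 + 2 * z ^ 2) * (P z + E z) ^ 2 := by rw [← sq_abs (P z + E z)]; ring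
  have hexp : ∀ (c z : ℝ), HasDerivAt (fun z => Real.exp (c * (4 * z + 2 / 3 * z ^ 3)))
      (Real.exp (c * (4 * z + 2 / 3 * z ^ 3)) * (c * (4 + 2 * z ^ 2))) z := fun c z => by
    refine (((((hasDerivAt_id z).const_mul 4).fun_add
      (((hasDerivAt_id z).fun_pow 3).const_mul (2 / 3))).const_mul c).exp).congr_deriv ?_
    simp only [id_eq, Nat.cast_ofNat, Nat.reduceSub]; ring
  have hprod : ∀ (c z : ℝ), HasDerivAt
      (fun z => Real.exp (c * (4 * z + 2 / 3 * z ^ 3)) * (P z + E z) ^ 2)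
      (Real.exp (c * (4 * z + 2 / 3 * z ^ 3)) * (c * ((4 + 2 * z ^ 2) * (P z + E z) ^ 2)
        + 2 * (P z + E z) * (2 * (1 + z) * R z))) z := fun c z => by
    refine ((hexp c z).fun_mul ((hS z).fun_pow 2)).congr_deriv ?_
    simp only [Nat.cast_ofNat, Nat.reduceSub]; ring
  have conclude : ∀ c : ℝ, Real.exp (c * (4 * z + 2 / 3 * z ^ 3)) * (P z + E z) ^ 2 ≤
      Real.exp (c * (4 * z₀ + 2 / 3 * z₀ ^ 3)) * (P z₀ + E z₀) ^ 2 → P z + E z = 0 := by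
    intro c hc
    rw [h₀] at hc
    have : (P z + E z) ^ 2 ≤ 0 := by
      by_contra! hlt
      have := mul_pos (Real.exp_pos (c * (4 * z + 2 / 3 * z ^ 3))) hlt
      linarith
    nlinarith
  rcases le_total z₀ z with hz | hz
  · refine conclude (-1) (antitone_of_hasDerivAt_nonpos (hprod (-1)) (fun x => ?_) hz)
    have := (abs_le.1 (hb x)).2
    exact mul_nonpos_of_nonneg_of_nonpos (Real.exp_pos _).le (by linarith)
  · refine conclude 1 (monotone_of_hasDerivAt_nonneg (hprod 1) (fun x => ?_) hz)
    have := (abs_le.1 (hb x)).1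
    exact mul_nonneg (Real.exp_pos _).le (by linarith)

/-- A nontrivial solution has a definite sign. -/
theorem sign (h : IsAirySquare P R E) (hne : ∃ z, P z ≠ 0) :
    (∀ z, 0 ≤ P z ∧ 0 ≤ E z ∧ 0 < P z + E z) ∨ (∀ z, P z ≤ 0 ∧ E z ≤ 0 ∧ P z + E z < 0) := by
  have hS : ∀ z, P z + E z ≠ 0 := by
    intro z₀ h₀
    obtain ⟨z, hz⟩ := hne
    have e := h.P_add_E_eq_zero h₀ z
    have hm := h.mul_eq z
    rw [show E z = -P z by linarith] at hm
    exact hz (by nlinarith [sq_nonneg (R z)])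
  have hc : Continuous fun z => P z + E z := continuous_iff_continuousAt.2 fun z =>
    ((h.hasDerivAt_P z).continuousAt).add (h.hasDerivAt_E z).continuousAt
  have hm : ∀ z, 0 ≤ P z * E z := fun z => by rw [h.mul_eq]; positivity
  rcases (hS 0).lt_or_gt with h0 | h0
  · right
    intro z
    have hz : P z + E z < 0 := by
      by_contra! hcon
      obtain ⟨y, hy⟩ := mem_range_of_exists_le_of_exists_ge hc ⟨0, h0.le⟩ ⟨z, hcon⟩
      exact hS y hy
    refine ⟨?_, ?_, hz⟩ <;> by_contra! hp <;> nlinarith [hm z]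
  · left
    intro z
    have hz : 0 < P z + E z := by
      by_contra! hcon
      obtain ⟨y, hy⟩ := mem_range_of_exists_le_of_exists_ge hc ⟨z, hcon⟩ ⟨0, h0.le⟩
      exact hS y hy
    refine ⟨?_, ?_, hz⟩ <;> by_contra! hp <;> nlinarith [hm z]

end IsAirySquare

/-- The third-order equation is the law for `R'`, and the first integral is `P E = R²`. With this
choice `E - z P = F`. -/
theorem isAirySquare_of_profile {F F₁ F₂ F₃ : ℝ → ℝ}
    (h₁ : ∀ z, HasDerivAt F (F₁ z) z) (h₂ : ∀ z, HasDerivAt F₁ (F₂ z) z)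
    (h₃ : ∀ z, HasDerivAt F₂ (F₃ z) z)
    (h : ∀ z, F₃ z = 4 * z * F₁ z - 2 * F z ∧ F₂ z ^ 2 = 4 * z * F₁ z ^ 2 - 4 * F z * F₁ z) :
    IsAirySquare (fun z => -F₁ z) (fun z => -F₂ z / 2) (fun z => F z - z * F₁ z) where
  hasDerivAt_P z := (h₂ z).fun_neg.congr_deriv (by ring)
  hasDerivAt_R z := ((h₃ z).fun_neg.div_const 2).congr_deriv (by rw [(h z).1]; ring)
  hasDerivAt_E z := ((h₁ z).fun_sub ((hasDerivAt_id z).fun_mul (h₂ z))).congr_deriv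
    (by simp only [id_eq]; ring)
  mul_eq z := by linear_combination (-1 / 4) * (h z).2

/-! ### Blow-up at a simple zero -/

/-- Where the argument of the logarithm has a simple zero, the wave is unbounded. -/
theorem not_isBoundedOnSlices_of_neg {F F₁ F₂ : ℝ → ℝ}
    (h₁ : ∀ z, HasDerivAt F (F₁ z) z) (h₂ : ∀ z, HasDerivAt F₁ (F₂ z) z) (hc : Continuous F₂)
    {z₀ : ℝ} (hneg : F z₀ < 0) (hne : F₁ z₀ ≠ 0) :
    ¬ IsBoundedOnSlices (waveDomain F) (wave F) := by
  intro hbdd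
  have hFc : Continuous F := continuous_iff_continuousAt.2 fun z => (h₁ z).continuousAt
  have hF₁c : Continuous F₁ := continuous_iff_continuousAt.2 fun z => (h₂ z).continuousAt
  obtain ⟨s, hs⟩ : ∃ s, s = -F z₀ := ⟨_, rfl⟩
  have hs0 : 0 < s := by linarith
  obtain ⟨M, hM⟩ := hbdd (s ^ 3 / 6) (by positivity)
  -- Multiplying the bound by `(s + F)²` gives a closed condition, which persists at the zero `z₀`
  -- of `s + F` and reads `F₁ z₀ ^ 2 ≤ 0` there. The point `z₀` is in the closure, since otherwise
  -- it would be a local maximum of `F`.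
  have hsub : {z | 0 < s + F z} ⊆
      {z | F₁ z ^ 2 - F₂ z * (s + F z) - M * s ^ 2 / 6 * (s + F z) ^ 2 ≤ 0} := by
    intro z hz
    have hz' : 0 < s + F z := hz
    have hsz : s * z / s = z := by field_simp
    have hpos : 0 < scale (s ^ 3 / 6) + F (s * z / scale (s ^ 3 / 6)) := by
      rwa [scale_cube hs0, hsz]
    have hb := hM (s * z) ⟨by positivity, (selfSimilar_pos_iff (by positivity) _).2 hpos⟩
    rw [wave_eq h₁ h₂ (by positivity) hpos, scale_cube hs0, hsz] at hb
    have hb' := (abs_le.1 hb).2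
    have e : F₁ z ^ 2 - F₂ z * (s + F z) = (s ^ 2 / 6 * (s + F z) ^ 2) *
        (-6 / s ^ 2 * (F₂ z / (s + F z) - (F₁ z / (s + F z)) ^ 2)) := by
      field_simp; ring
    have := mul_le_mul_of_nonneg_left hb' (show 0 ≤ s ^ 2 / 6 * (s + F z) ^ 2 by positivity)
    show _ ≤ (0 : ℝ)
    rw [e]
    linarith
  have hmem : z₀ ∈ closure {z | 0 < s + F z} := by
    by_contra hcon
    have hmax : IsLocalMax F z₀ := by
      filter_upwards [isClosed_closure.isOpen_compl.mem_nhds hcon] with y hy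
      have : ¬ 0 < s + F y := fun h => hy (subset_closure h)
      linarith
    exact hne (hmax.hasDerivAt_eq_zero (h₁ z₀))
  have hfin := closure_minimal hsub (isClosed_le (by fun_prop) continuous_const) hmem
  have e : s + F z₀ = 0 := by linarith
  simp only [Set.mem_ofPred_eq, e] at hfin
  have : 0 < F₁ z₀ ^ 2 := by positivity
  linarith

/-! ### Asymptotics at both ends -/

namespace IsAirySquare

variable {P R E : ℝ → ℝ}

theorem hasDerivAt_E_sub (h : IsAirySquare P R E) (z : ℝ) :
    HasDerivAt (fun z => E z - z * P z) (-P z) z :=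
  ((h.hasDerivAt_E z).fun_sub ((hasDerivAt_id z).fun_mul (h.hasDerivAt_P z))).congr_deriv
    (by simp only [id_eq]; ring)

theorem monotoneOn_R (h : IsAirySquare P R E) (hP : ∀ z, 0 ≤ P z) (hE : ∀ z, 0 ≤ E z) :
    MonotoneOn R (Set.Ici 0) := by
  refine monotoneOn_of_hasDerivWithinAt_nonneg (convex_Ici 0)
    (fun z _ => (h.hasDerivAt_R z).continuousAt.continuousWithinAt)
    (fun z _ => (h.hasDerivAt_R z).hasDerivWithinAt) (fun z hz => ?_)
  rw [interior_Ici] at hz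
  have : 0 < z := hz
  have := hP z
  have := hE z
  positivity

/-- Mean value estimate for `P' = 2 R` with `R` monotone. -/
theorem P_sub_bounds (h : IsAirySquare P R E) (hP : ∀ z, 0 ≤ P z) (hE : ∀ z, 0 ≤ E z)
    {a b : ℝ} (ha : 0 ≤ a) (hab : a < b) :
    2 * R a * (b - a) ≤ P b - P a ∧ P b - P a ≤ 2 * R b * (b - a) := by
  obtain ⟨c, hc, he⟩ := exists_hasDerivAt_eq_slope P (fun z => 2 * R z) hab
    (fun z _ => (h.hasDerivAt_P z).continuousAt.continuousWithinAt)
    (fun z _ => h.hasDerivAt_P z)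
  have hba : 0 < b - a := by linarith
  rw [eq_div_iff hba.ne'] at he
  have hmono := h.monotoneOn_R hP hE
  have h1 : R a ≤ R c := hmono ha (ha.trans hc.1.le) hc.1.le
  have h2 : R c ≤ R b := hmono (ha.trans hc.1.le) (ha.trans hab.le) hc.2.le
  rw [← he]
  constructor <;> gcongr

/-- If `R z > 0`, then `P` stays above `P z > 0` afterwards, and `E - z P`, whose derivative is
`-P`, eventually becomes negative. This excludes growing Airy solutions. -/
theorem R_nonpos (h : IsAirySquare P R E) (hP : ∀ z, 0 ≤ P z) (hE : ∀ z, 0 ≤ E z)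
    (hG : ∀ z, 0 ≤ E z - z * P z) {z : ℝ} (hz : 0 ≤ z) : R z ≤ 0 := by
  by_contra! hR
  have hPz : 0 < P z := by
    refine (hP z).lt_of_ne fun h0 => ?_
    have := h.mul_eq z
    rw [← h0] at this
    nlinarith
  have hge : ∀ y, z < y → P z ≤ P y := fun y hy => by
    have := (h.P_sub_bounds hP hE hz hy).1
    have : 0 < 2 * R z * (y - z) := mul_pos (by linarith) (by linarith)
    linarith
  -- At slope at most `-P z`, the value `E z - z * P z` is used up one unit before `b`.
  set b := z + (E z - z * P z) / P z + 1 with hb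
  have hzb : z < b := by
    have := div_nonneg (hG z) hPz.le
    linarith
  obtain ⟨c, hc, he⟩ := exists_hasDerivAt_eq_slope (fun z => E z - z * P z) (fun z => -P z) hzb
    (fun z _ => (h.hasDerivAt_E_sub z).continuousAt.continuousWithinAt)
    (fun z _ => h.hasDerivAt_E_sub z)
  have hba : 0 < b - z := by linarith
  rw [eq_div_iff hba.ne'] at he
  have h1 : P z * (b - z) ≤ P c * (b - z) := by gcongr; exact hge c hc.1
  have h2 : P z * (b - z) = E z - z * P z + P z := by rw [hb]; field_simp; ring
  have := hG b
  linarith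

/-- `E - z P` decreases and is bounded below, so its unit increments tend to zero; they dominate
`P`, which is nonincreasing on the positive axis. -/
theorem tendsto_P_atTop (h : IsAirySquare P R E) (hP : ∀ z, 0 ≤ P z) (hE : ∀ z, 0 ≤ E z)
    (hG : ∀ z, 0 ≤ E z - z * P z) : Tendsto P atTop (𝓝 0) := by
  have hanti : Antitone (fun z => E z - z * P z) :=
    antitone_of_hasDerivAt_nonpos h.hasDerivAt_E_sub fun z => by simpa using hP z
  obtain ⟨l, hl⟩ : ∃ l, Tendsto (fun z => E z - z * P z) atTop (𝓝 l) :=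
    ⟨_, tendsto_atTop_ciInf hanti ⟨0, by rintro _ ⟨z, rfl⟩; exact hG z⟩⟩
  have hdiff := (hl.comp (tendsto_atTop_add_const_right atTop (-1 : ℝ) tendsto_id)).sub hl
  rw [sub_self] at hdiff
  refine tendsto_of_tendsto_of_tendsto_of_le_of_le' tendsto_const_nhds hdiff
    (Eventually.of_forall hP) ?_
  filter_upwards [eventually_gt_atTop 1] with z hz
  obtain ⟨c, hc, he⟩ := exists_hasDerivAt_eq_slope (fun z => E z - z * P z) (fun z => -P z)
    (show z + -1 < z by linarith)
    (fun z _ => (h.hasDerivAt_E_sub z).continuousAt.continuousWithinAt)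
    (fun z _ => h.hasDerivAt_E_sub z)
  have hc0 : 0 ≤ c := by linarith [hc.1]
  have h1 := (h.P_sub_bounds hP hE hc0 hc.2).2
  have h2 := h.R_nonpos hP hE hG (show 0 ≤ z by linarith)
  have h3 : 2 * R z * (z - c) ≤ 0 :=
    mul_nonpos_of_nonpos_of_nonneg (by linarith) (by linarith [hc.2])
  have e : z - (z + -1) = 1 := by ring
  rw [e, div_one] at he
  simp only [Function.comp_def, id_eq]
  linarith

theorem tendsto_R_atTop (h : IsAirySquare P R E) (hP : ∀ z, 0 ≤ P z) (hE : ∀ z, 0 ≤ E z)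
    (hG : ∀ z, 0 ≤ E z - z * P z) : Tendsto R atTop (𝓝 0) := by
  have hPt := h.tendsto_P_atTop hP hE hG
  have hdiff := (hPt.sub (hPt.comp
    (tendsto_atTop_add_const_right atTop (-1 : ℝ) tendsto_id))).div_const 2
  rw [sub_self, zero_div] at hdiff
  refine tendsto_of_tendsto_of_tendsto_of_le_of_le' hdiff tendsto_const_nhds ?_ ?_
  · filter_upwards [eventually_gt_atTop 1] with z hz
    have := (h.P_sub_bounds hP hE (show 0 ≤ z + -1 by linarith)
      (show z + -1 < z by linarith)).2
    simp only [Function.comp_def, id_eq]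
    linarith
  · filter_upwards [eventually_gt_atTop 1] with z hz
    exact h.R_nonpos hP hE hG (by linarith)

/-- AM-GM for `E` and `-z P`, whose product is `-z R²`. -/
theorem sq_R_le (h : IsAirySquare P R E) {z : ℝ} : 4 * (-z) * R z ^ 2 ≤ (E z - z * P z) ^ 2 := by
  rw [← h.mul_eq z]
  nlinarith [sq_nonneg (E z + z * P z)]

theorem tendsto_P_div (h : IsAirySquare P R E) (hP : ∀ z, 0 ≤ P z) (hE : ∀ z, 0 ≤ E z)
    (hG : ∀ z, 0 ≤ E z - z * P z) {s : ℝ} (hs : 0 < s) :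
    Tendsto (fun z => P z / (s + (E z - z * P z))) (atBot ⊔ atTop) (𝓝 0) := by
  refine tendsto_sup.2 ⟨?_, ?_⟩
  · refine tendsto_of_tendsto_of_tendsto_of_le_of_le' tendsto_const_nhds
      (tendsto_inv_atTop_zero.comp tendsto_neg_atBot_atTop) (Eventually.of_forall fun z => ?_) ?_
    · exact div_nonneg (hP z) (by linarith [hG z])
    · filter_upwards [eventually_lt_atBot 0] with z hz
      have h1 := hG z
      have h2 : 0 < -z := by linarith
      simp only [Function.comp_def]
      rw [div_le_iff₀ (by linarith), inv_mul_eq_div, le_div_iff₀ h2]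
      linarith [hE z]
  · refine squeeze_zero (fun z => div_nonneg (hP z) (by linarith [hG z])) (fun z => ?_)
      (by simpa using (h.tendsto_P_atTop hP hE hG).div_const s)
    exact div_le_div_of_nonneg_left (hP z) hs (by linarith [hG z])

theorem tendsto_R_div (h : IsAirySquare P R E) (hP : ∀ z, 0 ≤ P z) (hE : ∀ z, 0 ≤ E z)
    (hG : ∀ z, 0 ≤ E z - z * P z) {s : ℝ} (hs : 0 < s) :
    Tendsto (fun z => R z / (s + (E z - z * P z))) (atBot ⊔ atTop) (𝓝 0) := by
  refine tendsto_sup.2 ⟨?_, ?_⟩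
  · have hlim : Tendsto (fun z : ℝ => √((-z)⁻¹)) atBot (𝓝 0) := by
      have := (Real.continuous_sqrt.tendsto 0).comp
        (tendsto_inv_atTop_zero.comp (tendsto_neg_atBot_atTop (G := ℝ)))
      simpa [Function.comp_def] using this
    refine squeeze_zero_norm' ?_ hlim
    filter_upwards [eventually_lt_atBot 0] with z hz
    have h1 := hG z
    have h2 : 0 < -z := by linarith
    refine Real.abs_le_sqrt ?_
    rw [div_pow, div_le_iff₀ (by positivity), inv_mul_eq_div, le_div_iff₀ h2]
    have := h.sq_R_le (z := z)
    have h3 : (E z - z * P z) ^ 2 ≤ (s + (E z - z * P z)) ^ 2 := by gcongr; linarith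
    nlinarith [sq_nonneg (R z)]
  · have hlim : Tendsto (fun z => |R z| / s) atTop (𝓝 0) := by
      simpa using (h.tendsto_R_atTop hP hE hG).abs.div_const s
    refine squeeze_zero_norm (fun z => ?_) hlim
    have h1 := hG z
    rw [Real.norm_eq_abs, abs_div, abs_of_pos (show 0 < s + (E z - z * P z) by linarith)]
    exact div_le_div_of_nonneg_left (abs_nonneg _) hs (by linarith)

/-! ### Failure of square integrability -/

/-- The oscillation towards `-∞` is not square integrable: `∫ (R / (E - z P))²` diverges
logarithmically. -/
theorem not_integrableOn_of_sq_le (h : IsAirySquare P R E) (hP : ∀ z, 0 ≤ P z)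
    (hE : ∀ z, 0 ≤ E z) (hS : ∀ z, 0 < P z + E z) {φ : ℝ → ℝ} {C : ℝ}
    (hφ : ∀ x, 1 ≤ x → (R (-x) / (E (-x) + x * P (-x))) ^ 2 ≤ φ x + C / x ^ 2) (hφ0 : ∀ x, 0 ≤ φ x) :
    ¬ IntegrableOn φ (Set.Ioi 1) := by
  intro hint
  set p : ℝ → ℝ := fun x => P (-x)
  set r : ℝ → ℝ := fun x => R (-x)
  set e : ℝ → ℝ := fun x => E (-x)
  set G : ℝ → ℝ := fun x => e x + x * p x
  have hp : ∀ x, HasDerivAt p (-(2 * r x)) x := fun x =>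
    ((h.hasDerivAt_P (-x)).scomp x (hasDerivAt_neg x)).congr_deriv (by simp [r])
  have hr : ∀ x, HasDerivAt r (x * p x - e x) x := fun x =>
    ((h.hasDerivAt_R (-x)).scomp x (hasDerivAt_neg x)).congr_deriv
      (by simp only [p, e, neg_smul, one_smul]; ring)
  have he : ∀ x, HasDerivAt e (2 * x * r x) x := fun x =>
    ((h.hasDerivAt_E (-x)).scomp x (hasDerivAt_neg x)).congr_deriv (by simp [r])
  have hGd : ∀ x, HasDerivAt G (p x) x := fun x =>
    ((he x).fun_add ((hasDerivAt_id x).fun_mul (hp x))).congr_deriv (by simp only [id_eq]; ring)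
  have hGpos : ∀ x, 1 ≤ x → 0 < G x := fun x hx => by
    have h1 : 0 < p x + e x := hS (-x)
    have h2 : p x ≤ x * p x := le_mul_of_one_le_left (hP _) hx
    simp only [G]; linarith
  -- With `ρ = r/G` and `D = (x p - e)/G` one has `4xρ² + D² = 1`, while `(ρD)' = D² - 4xρ²` up to
  -- `O(1/x)`. Hence `log x - ρD/x` has derivative `8ρ² + O(1/x²)`. The last term absorbs this error
  -- (at most `2/x²`) and the `8C/x²` from `hφ`, so that `V' ≤ 8φ`.
  let V : ℝ → ℝ := fun x => Real.log x - r x / G x * ((x * p x - e x) / G x) / x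
    + (8 * C + 2) / x
  let V' : ℝ → ℝ := fun x => 1 / x - (((((x * p x - e x) * G x - r x * p x) / G x ^ 2)
      * ((x * p x - e x) / G x) + r x / G x * (((p x - 4 * x * r x) * G x - (x * p x - e x) * p x)
        / G x ^ 2)) * x - r x / G x * ((x * p x - e x) / G x)) / x ^ 2
    - (8 * C + 2) / x ^ 2
  have hV : ∀ x, 1 ≤ x → HasDerivAt V (V' x) x := fun x hx => by
    have hG := (hGpos x hx).ne'
    have hx0 : x ≠ 0 := by positivity
    have hD : HasDerivAt (fun x => x * p x - e x) (p x - 4 * x * r x) x :=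
      (((hasDerivAt_id x).fun_mul (hp x)).fun_sub (he x)).congr_deriv
        (by simp only [id_eq]; ring)
    refine (((Real.hasDerivAt_log hx0).fun_sub ((((hr x).fun_div (hGd x) hG).fun_mul
      (hD.fun_div (hGd x) hG)).fun_div (hasDerivAt_id x) hx0)).fun_add
      ((hasDerivAt_const x (8 * C + 2)).fun_div (hasDerivAt_id x) hx0)).congr_deriv ?_
    simp only [V', id_eq]
    ring
  have bounds : ∀ x, 1 ≤ x → |r x / G x| ≤ 1 / 2 ∧ |(x * p x - e x) / G x| ≤ 1 ∧
      0 ≤ p x / G x ∧ p x / G x ≤ 1 / x := fun x hx => by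
    have hG := hGpos x hx
    have hpx : 0 ≤ p x := hP _
    have hex : 0 ≤ e x := hE _
    have hx0 : 0 < x := by linarith
    have hxp : 0 ≤ x * p x := by positivity
    have hm : p x * e x = r x ^ 2 := h.mul_eq _
    refine ⟨?_, ?_, by positivity, ?_⟩
    · rw [abs_div, abs_of_pos hG, div_le_iff₀ hG]
      apply abs_le_of_sq_le_sq _ (by positivity)
      have : p x * e x ≤ x * (p x * e x) := le_mul_of_one_le_left (by positivity) hx
      simp only [G]
      nlinarith [sq_nonneg (e x - x * p x)]
    · rw [abs_div, abs_of_pos hG, div_le_one hG, abs_le]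
      simp only [G]
      constructor <;> linarith
    · rw [div_le_div_iff₀ hG hx0]
      simp only [G]
      linarith
  have hle : ∀ x, 1 ≤ x → V' x ≤ 8 * φ x := fun x hx => by
    have hG := (hGpos x hx).ne'
    have hx0 : 0 < x := by linarith
    obtain ⟨b1, b2, b3, b4⟩ := bounds x hx
    have hm : p x * e x = r x ^ 2 := h.mul_eq _
    have key : 4 * x * (r x / G x) ^ 2 + ((x * p x - e x) / G x) ^ 2 = 1 := by
      field_simp
      rw [← hm]
      simp only [G]; ring
    have hq := hφ x hx
    change (r x / G x) ^ 2 ≤ φ x + C / x ^ 2 at hq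
    set ρ := r x / G x with hρ
    set D := (x * p x - e x) / G x with hD
    set q := p x / G x with hqd
    have e1 : ((x * p x - e x) * G x - r x * p x) / G x ^ 2 = D - ρ * q := by
      rw [hD, hρ, hqd]; field_simp
    have e2 : ((p x - 4 * x * r x) * G x - (x * p x - e x) * p x) / G x ^ 2
        = q - 4 * x * ρ - D * q := by
      rw [hD, hρ, hqd]; field_simp
    have eV : V' x = 8 * ρ ^ 2 + (x * q * (2 * ρ * D - ρ) + ρ * D) / x ^ 2 - (8 * C + 2) / x ^ 2 := by
      have : V' x = 1 / x - (((D - ρ * q) * D + ρ * (q - 4 * x * ρ - D * q)) * x - ρ * D) / x ^ 2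
          - (8 * C + 2) / x ^ 2 := by simp only [V', e1, e2, ← hρ, ← hD]
      rw [this]
      field_simp
      linear_combination (-x) * key
    have hxq : x * q ≤ 1 := by
      have := mul_le_mul_of_nonneg_left b4 hx0.le
      rwa [mul_one_div_cancel hx0.ne'] at this
    have hxq0 : 0 ≤ x * q := by positivity
    have hρD : |ρ * D| ≤ 1 / 2 := by
      rw [abs_mul]; nlinarith [abs_nonneg ρ, abs_nonneg D]
    have herr : x * q * (2 * ρ * D - ρ) + ρ * D ≤ 2 := by
      have a1 := abs_le.1 hρD
      have a2 := abs_le.1 b1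
      have : 2 * ρ * D - ρ ≤ 3 / 2 := by linarith
      nlinarith
    have hx2 : 0 < x ^ 2 := by positivity
    have : (x * q * (2 * ρ * D - ρ) + ρ * D) / x ^ 2 ≤ 2 / x ^ 2 := by gcongr
    rw [eV]
    have e3 : (8 * C + 2) / x ^ 2 = 8 * (C / x ^ 2) + 2 / x ^ 2 := by ring
    rw [e3]
    linarith
  have hup : ∀ X, 1 ≤ X → V X ≤ V 1 + ∫ x in Set.Ioi 1, 8 * φ x := fun X hX => by
    have hint8 : IntegrableOn (fun x => 8 * φ x) (Set.Ioi 1) := hint.const_mul 8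
    have h1 : V X - V 1 ≤ ∫ x in (1 : ℝ)..X, 8 * φ x := by
      refine intervalIntegral.sub_le_integral_of_hasDeriv_right_of_le hX
        (fun x hx => (hV x hx.1).continuousAt.continuousWithinAt)
        (fun x hx => (hV x hx.1.le).hasDerivWithinAt) ?_ (fun x hx => hle x hx.1.le)
      rw [integrableOn_Icc_iff_integrableOn_Ioc]
      exact hint8.mono_set Set.Ioc_subset_Ioi_self
    have h2 : ∫ x in (1 : ℝ)..X, 8 * φ x ≤ ∫ x in Set.Ioi 1, 8 * φ x := by
      rw [intervalIntegral.integral_of_le hX]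
      exact setIntegral_mono_set hint8 (Eventually.of_forall fun x => by
        have := hφ0 x; simp; linarith) (Set.Ioc_subset_Ioi_self.eventuallyLE)
    linarith
  have hlow : ∀ X, 1 ≤ X → Real.log X ≤ V X + 1 + |8 * C + 2| := fun X hX => by
    obtain ⟨b1, b2, -, -⟩ := bounds X hX
    have hX0 : 0 < X := by linarith
    have a1 : |r X / G X * ((X * p X - e X) / G X) / X| ≤ 1 := by
      rw [abs_div, abs_mul, abs_of_pos hX0, div_le_one hX0]
      nlinarith [abs_nonneg (r X / G X), abs_nonneg ((X * p X - e X) / G X)]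
    have a2 : |(8 * C + 2) / X| ≤ |8 * C + 2| := by
      rw [abs_div, abs_of_pos hX0]
      exact div_le_self (abs_nonneg _) hX
    have a1' := abs_le.1 a1
    have a2' := abs_le.1 a2
    simp only [V]
    linarith
  obtain ⟨X, hX, hX1⟩ := ((Real.tendsto_log_atTop.eventually_gt_atTop
    (V 1 + (∫ x in Set.Ioi 1, 8 * φ x) + 1 + |8 * C + 2|)).and (eventually_ge_atTop 1)).exists
  have := hup X hX1
  have := hlow X hX1
  linarith

end IsAirySquare

/-! ### From the profile back to the wave -/

theorem wave_eq_zero_of_forall_hasDerivAt_zero {F : ℝ → ℝ} (hF : ∀ z, HasDerivAt F 0 z)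
    (ρ τ : ℝ) : wave F ρ τ = 0 := by
  have : (fun t => Real.log (selfSimilar F ρ t)) = fun _ => Real.log (selfSimilar F ρ 0) := by
    funext t
    rw [selfSimilar_eq, selfSimilar_eq,
      eq_of_forall_hasDerivAt_zero hF (t / scale ρ) (0 / scale ρ)]
  rw [wave, this]
  simp [iteratedDeriv_const]

section Profile

variable {F F₁ F₂ : ℝ → ℝ} {ρ : ℝ}

/-- Decay of the logarithmic derivatives of a nonnegative profile gives decay and zero mean of
the wave. -/
theorem tendsto_wave_and_hasImproperIntegral
    (h₁ : ∀ z, HasDerivAt F (F₁ z) z) (h₂ : ∀ z, HasDerivAt F₁ (F₂ z) z) (hc : Continuous F₂)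
    (hF : ∀ z, 0 ≤ F z) (hρ : 0 < ρ)
    (hl₁ : Tendsto (fun z => F₁ z / (scale ρ + F z)) (atBot ⊔ atTop) (𝓝 0))
    (hl₂ : Tendsto (fun z => F₂ z / (scale ρ + F z)) (atBot ⊔ atTop) (𝓝 0)) :
    Tendsto (wave F ρ) (atBot ⊔ atTop) (𝓝 0) ∧ HasImproperIntegral (wave F ρ) 0 := by
  have hs := scale_pos hρ
  have hN : ∀ z, 0 < scale ρ + F z := fun z => by linarith [hF z]
  have hw : wave F ρ = fun τ => -6 / scale ρ ^ 2 * (F₂ (τ / scale ρ) / (scale ρ + F (τ / scale ρ))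
      - (F₁ (τ / scale ρ) / (scale ρ + F (τ / scale ρ))) ^ 2) :=
    funext fun τ => wave_eq h₁ h₂ hρ (hN _)
  set s := scale ρ
  have hFc : Continuous F := continuous_iff_continuousAt.2 fun z => (h₁ z).continuousAt
  have hF₁c : Continuous F₁ := continuous_iff_continuousAt.2 fun z => (h₂ z).continuousAt
  have hdb : Tendsto (fun t : ℝ => t / s) atBot atBot := tendsto_id.atBot_div_const hs
  have hdt : Tendsto (fun t : ℝ => t / s) atTop atTop := tendsto_id.atTop_div_const hs
  have hd : Tendsto (fun t : ℝ => t / s) (atBot ⊔ atTop) (atBot ⊔ atTop) := hdb.sup_sup hdt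
  have hwc : Continuous (wave F ρ) := by
    rw [hw]
    have : ∀ τ, s + F (τ / s) ≠ 0 := fun τ => (hN _).ne'
    fun_prop (disch := assumption)
  have hanti : ∀ τ, HasDerivAt (fun τ => -6 / s * (F₁ (τ / s) / (s + F (τ / s)))) (wave F ρ τ) τ :=
    fun τ => by
      have hNτ := (hN (τ / s)).ne'
      refine (((hasDerivAt_comp_div h₂ s τ).fun_div
        ((hasDerivAt_comp_div h₁ s τ).const_add s) hNτ).const_mul (-6 / s)).congr_deriv ?_
      rw [hw]
      field_simp
  refine ⟨?_, hwc.locallyIntegrable, ?_⟩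
  · rw [hw]
    simpa [Function.comp_def] using
      ((hl₂.comp hd).sub ((hl₁.comp hd).pow 2)).const_mul (-6 / s ^ 2)
  · have hFTC : ∀ p : ℝ × ℝ, ∫ t in p.1..p.2, wave F ρ t =
        -6 / s * (F₁ (p.2 / s) / (s + F (p.2 / s))) - -6 / s * (F₁ (p.1 / s) / (s + F (p.1 / s))) :=
      fun p => intervalIntegral.integral_eq_sub_of_hasDerivAt (fun x _ => hanti x)
        (hwc.intervalIntegrable _ _)
    simp only [hFTC]
    have hA := ((hl₁.mono_left le_sup_left).comp hdb).const_mul (-6 / s)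
    have hB := ((hl₁.mono_left le_sup_right).comp hdt).const_mul (-6 / s)
    simpa [Function.comp_def] using
      (hB.comp (tendsto_snd (f := (atBot : Filter ℝ)))).sub
        (hA.comp (tendsto_fst (g := (atTop : Filter ℝ))))

/-- Towards `-∞` the wave is a multiple of `R/(s + F)` up to `(F₁/(s + F))² = O(1/x²)`, so its
square dominates `(R/F)²` up to a constant factor and an integrable error. -/
theorem not_memLp_wave (h₁ : ∀ z, HasDerivAt F (F₁ z) z) (h₂ : ∀ z, HasDerivAt F₁ (F₂ z) z)
    (hA : IsAirySquare (fun z => -F₁ z) (fun z => -F₂ z / 2) (fun z => F z - z * F₁ z))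
    (hP : ∀ z, 0 ≤ -F₁ z) (hE : ∀ z, 0 ≤ F z - z * F₁ z) (hS : ∀ z, 0 < -F₁ z + (F z - z * F₁ z))
    (hF : ∀ z, 0 ≤ F z) (hρ : 0 < ρ) :
    ¬ MemLp (wave F ρ) 2 volume := by
  intro hmem
  have hs := scale_pos hρ
  have hN : ∀ z, 0 < scale ρ + F z := fun z => by linarith [hF z]
  have hw := fun τ => wave_eq h₁ h₂ (τ := τ) hρ (hN _)
  set s := scale ρ
  have hanti : Antitone F := antitone_of_hasDerivAt_nonpos h₁ fun z => by simpa using hP z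
  have hm1 : 0 < F (-1) := by linarith [hS (-1)]
  -- `F` is antitone, so `κ` bounds `(s + F)/F` on `(-∞, -1]`: the price of replacing the
  -- denominator `s + F` by `F`.
  set κ := 1 + s / F (-1) with hκ
  refine hA.not_integrableOn_of_sq_le hP hE hS
    (φ := fun x => κ ^ 2 * s ^ 4 / 72 * wave F ρ (-s * x) ^ 2) (C := κ ^ 2 / 2) ?_
    (fun x => by positivity) ?_
  · intro x hx
    have hx0 : 0 < x := by linarith
    have hFx : 0 < F (-x) := hm1.trans_le (hanti (by linarith))
    have hNx := hN (-x)
    have e₁ : -F₂ (-x) / 2 / (F (-x) - -x * F₁ (-x) + x * -F₁ (-x))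
        = (1 + s / F (-x)) * (-F₂ (-x) / 2 / (s + F (-x))) := by
      rw [show F (-x) - -x * F₁ (-x) + x * -F₁ (-x) = F (-x) by ring]
      field_simp
      ring
    have e₂ : -F₂ (-x) / 2 / (s + F (-x))
        = s ^ 2 * wave F ρ (-s * x) / 12 - (F₁ (-x) / (s + F (-x))) ^ 2 / 2 := by
      rw [hw, show -s * x / s = -x by field_simp]
      field_simp
      ring
    have hk : 1 + s / F (-x) ≤ κ := by
      rw [hκ]; gcongr; exact hanti (by linarith)
    have hu : (F₁ (-x) / (s + F (-x))) ^ 2 ≤ 1 / x := by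
      have h1 : |F₁ (-x) / (s + F (-x))| ≤ 1 / x := by
        have := hP (-x)
        rw [abs_div, abs_of_pos hNx, abs_of_nonpos (by linarith), div_le_div_iff₀ hNx hx0]
        have := hE (-x)
        linarith
      have h2 : 1 / x ≤ 1 := by rw [div_le_one hx0]; exact hx
      rw [← sq_abs]
      nlinarith [abs_nonneg (F₁ (-x) / (s + F (-x)))]
    rw [e₁, e₂]
    set u := (F₁ (-x) / (s + F (-x))) ^ 2
    have hu0 : 0 ≤ u := sq_nonneg _
    set A := wave F ρ (-s * x)
    have hu2 : u ^ 2 ≤ 1 / x ^ 2 := by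
      rw [show 1 / x ^ 2 = (1 / x) ^ 2 by ring]; gcongr
    calc ((1 + s / F (-x)) * (s ^ 2 * A / 12 - u / 2)) ^ 2
        = (1 + s / F (-x)) ^ 2 * (s ^ 2 * A / 12 - u / 2) ^ 2 := by ring
      _ ≤ κ ^ 2 * (s ^ 2 * A / 12 - u / 2) ^ 2 := by gcongr
      _ ≤ κ ^ 2 * (s ^ 4 * A ^ 2 / 72 + u ^ 2 / 2) := by
          gcongr
          nlinarith [sq_nonneg (s ^ 2 * A / 12 + u / 2)]
      _ ≤ κ ^ 2 * (s ^ 4 * A ^ 2 / 72 + 1 / x ^ 2 / 2) := by gcongr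
      _ = κ ^ 2 * s ^ 4 / 72 * A ^ 2 + κ ^ 2 / 2 / x ^ 2 := by ring
  · exact ((hmem.integrable_sq.comp_mul_left' (R := -s) (by simpa using hs.ne')).const_mul
      (κ ^ 2 * s ^ 4 / 72)).integrableOn

end Profile

end CKdV

end

/-! ### Choice of sign and conclusion -/

theorem theorem1p3 (F : ℝ → ℝ) (hF : ContDiff ℝ ∞ F)
    (hsol : CKdV.IsSolutionOn (CKdV.waveDomain F) (CKdV.wave F))
    (hbdd : CKdV.IsBoundedOnSlices (CKdV.waveDomain F) (CKdV.wave F)) :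
    (∀ ρ : ℝ, 0 < ρ →
      Tendsto (CKdV.wave F ρ) (atBot ⊔ atTop) (𝓝 0) ∧
      CKdV.HasImproperIntegral (CKdV.wave F ρ) 0) ∧
    ((∃ ρ τ : ℝ, 0 < ρ ∧ CKdV.wave F ρ τ ≠ 0) →
      ∀ ρ : ℝ, 0 < ρ →
        (∀ τ : ℝ, 0 < CKdV.selfSimilar F ρ τ) ∧
        ¬ MemLp (CKdV.wave F ρ) 2 volume) := by
  have hd : ∀ n z, HasDerivAt (iteratedDeriv n F) (iteratedDeriv (n + 1) F z) z := fun n z => by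
    rw [iteratedDeriv_succ]
    exact (hF.differentiable_iteratedDeriv n (by exact_mod_cast WithTop.coe_lt_top _) z).hasDerivAt
  have h₁ : ∀ z, HasDerivAt F (iteratedDeriv 1 F z) z := by simpa using hd 0
  have hc : Continuous (iteratedDeriv 2 F) :=
    continuous_iff_continuousAt.2 fun z => (hd 2 z).continuousAt
  by_cases hconst : ∀ z, iteratedDeriv 1 F z = 0
  · have hw : ∀ ρ τ, CKdV.wave F ρ τ = 0 :=
      CKdV.wave_eq_zero_of_forall_hasDerivAt_zero fun z => hconst z ▸ h₁ z
    refine ⟨fun ρ _ => ?_, fun ⟨ρ, τ, _, hne⟩ => absurd (hw ρ τ) hne⟩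
    rw [show CKdV.wave F ρ = fun _ => 0 from funext (hw ρ)]
    exact ⟨tendsto_const_nhds, continuous_const.locallyIntegrable, by simp⟩
  push Not at hconst
  obtain ⟨z₁, hz₁⟩ := hconst
  have hA := CKdV.isAirySquare_of_profile h₁ (hd 1) (hd 2)
    (CKdV.profile_equations h₁ (hd 1) (hd 2) (hd 3) (hd 4) hsol hz₁)
  rcases hA.sign ⟨z₁, neg_ne_zero.2 hz₁⟩ with hpos | hneg
  -- Where `F < 0`, boundedness forces `F' = 0`, so `E = F < 0`, against the sign of `E`.
  · have hF0 : ∀ z, 0 ≤ F z := fun z => by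
      by_contra! hz
      refine CKdV.not_isBoundedOnSlices_of_neg h₁ (hd 1) hc hz (fun h0 => ?_) hbdd
      have := (hpos z).2.1
      rw [h0] at this
      linarith
    have hP := fun z => (hpos z).1
    have hE := fun z => (hpos z).2.1
    have eG : ∀ z, F z - z * iteratedDeriv 1 F z - z * -iteratedDeriv 1 F z = F z := fun z => by
      ring
    have hG : ∀ z, 0 ≤ F z - z * iteratedDeriv 1 F z - z * -iteratedDeriv 1 F z := fun z => by
      rw [eG]; exact hF0 z
    refine ⟨fun ρ hρ => ?_, fun _ ρ hρ => ⟨fun τ => ?_, ?_⟩⟩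
    · have hl₁ := (hA.tendsto_P_div hP hE hG (CKdV.scale_pos hρ)).neg
      have hl₂ := (hA.tendsto_R_div hP hE hG (CKdV.scale_pos hρ)).const_mul (-2)
      simp only [eG] at hl₁ hl₂
      refine CKdV.tendsto_wave_and_hasImproperIntegral h₁ (hd 1) hc hF0 hρ ?_ ?_
      · simpa [neg_div] using hl₁
      · rw [mul_zero] at hl₂
        refine hl₂.congr fun z => ?_
        ring
    · rw [CKdV.selfSimilar_pos_iff hρ]
      have := hF0 (τ / CKdV.scale ρ)
      have := CKdV.scale_pos hρ
      positivity
    · exact CKdV.not_memLp_wave h₁ (hd 1) hA hP hE (fun z => (hpos z).2.2) hF0 hρ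
  · exfalso
    -- With the opposite sign, `F = E - z P` is negative on the negative axis; boundedness makes
    -- `F'` vanish there, and `F''' = 4zF' - 2F` then gives `F = 0`.
    have hFneg : ∀ z < 0, F z < 0 := fun z hz => by
      obtain ⟨a, b, c⟩ := hneg z
      by_contra! hcon
      have h1 : 0 ≤ -z * -iteratedDeriv 1 F z := by nlinarith
      have h2 : -z * -iteratedDeriv 1 F z ≤ 0 := by nlinarith
      have h3 : iteratedDeriv 1 F z = 0 := by
        have : -z * -iteratedDeriv 1 F z = 0 := le_antisymm h2 h1
        rcases mul_eq_zero.1 this with h | h <;> linarith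
      rw [h3] at b c
      linarith
    have hzero : ∀ z < 0, iteratedDeriv 1 F z = 0 := fun z hz => by
      by_contra hne
      exact CKdV.not_isBoundedOnSlices_of_neg h₁ (hd 1) hc (hFneg z hz) hne hbdd
    have hloc : ∀ n, (∀ z < 0, iteratedDeriv n F z = 0) → ∀ z < 0, iteratedDeriv (n + 1) F z = 0 :=
      fun n hn z hz => (hd n z).unique ((hasDerivAt_const z 0).congr_of_eventuallyEq
        (by filter_upwards [gt_mem_nhds hz] with y hy using hn y hy))
    have hz₃ := hloc 2 (hloc 1 hzero)
    have := (CKdV.profile_equations h₁ (hd 1) (hd 2) (hd 3) (hd 4) hsol hz₁ (-1)).1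
    rw [hz₃ (-1) (by norm_num), hzero (-1) (by norm_num)] at this
    linarith [hFneg (-1) (by norm_num)]
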